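/- Let $A$ and $B$ be finite-dimensional quantum systems (with $A\neq\{0\}$), and let $\mathcal N,\mathcal M\in\mathrm{CPTP}(A\to B)$ be quantum channels, i.e. completely positive trace-preserving linear maps $\mathcal B(A)\to\mathcal B(B)$. Let $$\|\Phi\|_\diamond=\sup_{k}\ \sup_{\|X\|_1\le 1}\big\|(\mathsf{id}_k\otimes\Phi)(X)\big\|_1 ,$$ where $X$ ranges over the operators on $\mathbb C^k\otimes A$, be the diamond norm. Let $J^{\Phi}_{AB}=\sum_{x,y}|x\rangle\langle y|_A\otimes\Phi(|x\rangle\langle y|)$ be the Choi matrix of a linear map $\Phi:\mathcal B(A)\to\mathcal B(B)$, and write $\Psi\ge\Phi$ if $\Psi-\Phi$ is completely positive. Put $D_{\max}(\Phi\|\mathcal E)=\log_2\min\{t\ge 0 : t\,\mathcal E\ge\Phi\}$ (equal to $+\infty$ if there is no such $t$, and to $-\infty$ if the minimum is $0$) and $LR_{\mathrm{CPTP}}(\Phi)=\min_{\mathcal E\in\mathrm{CPTP}(A\to B)}D_{\max}(\Phi\|\mathcal E)$, with $2^{-\infty}=0$ and $2^{+\infty}=+\infty$. Then $$\begin{aligned}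 \tfrac12\|\mathcal N-\mathcal M\|_\diamond &=\min\big\{\|\omega_A\|_\infty : \omega_{AB}\ge 0,\ \omega_{AB}\ge J^{\mathcal N-\mathcal M}_{AB}\big\}\\ &=\min\big\{\lambda\in\mathbb R : \lambda J^{\mathcal E}_{AB}\ge J^{\mathcal N-\mathcal M}_{AB}\text{ for some }\mathcal E\in\mathrm{CPTP}(A\to B)\big\}\\ &=\min\big\{\lambda\in\mathbb R : \lambda\,\mathcal E\ge\mathcal N-\mathcal M\text{ for some }\mathcal E\in\mathrm{CPTP}(A\to B)\big\}\\ &=\min_{\mathcal E\in\mathrm{CPTP}(A\to B)}2^{D_{\max}(\mathcal N-\mathcal M\|\mathcal E)}=2^{LR_{\mathrm{CPTP}}(\mathcal N-\mathcal M)} , \end{aligned}$$ where $\omega_A=\mathrm{Tr}_B\,\omega_{AB}$, $\|\cdot\|_\infty$ is the operator norm, and all the minima are attained. -/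

import Mathlib

open scoped Matrix ComplexOrder MatrixOrder NNReal ENNReal

noncomputable section

namespace QChannel

/-- Linear maps `B(A) → B(B)`, where the finite-dimensional Hilbert spaces of the systems `A` and
`B` are `ℂ^A` and `ℂ^B` with their standard bases. -/
abbrev LMap (A B : Type*) : Type _ := Matrix A A ℂ →ₗ[ℂ] Matrix B B ℂ

/-- The action of `id_R ⊗ Φ` on an operator of the composite system `R A`: the map `Φ` is applied
to every `A`-block. -/
def ampliate (R : Type*) {A B : Type*} (Φ : LMap A B) (X : Matrix (R × A) (R × A) ℂ) :
    Matrix (R × B) (R × B) ℂ :=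
  Matrix.of fun p q => Φ (Matrix.of fun a a' => X (p.1, a) (q.1, a')) p.2 q.2

/-- Complete positivity: `id_k ⊗ Φ` preserves positive semidefiniteness for every `k`. -/
def IsCP {A B : Type*} (Φ : LMap A B) : Prop :=
  ∀ (k : ℕ) (X : Matrix (Fin k × A) (Fin k × A) ℂ),
    X.PosSemidef → (ampliate (Fin k) Φ X).PosSemidef

/-- Quantum channels: completely positive and trace-preserving linear maps, `CPTP(A → B)`. -/
structure IsCPTP {A B : Type*} [Fintype A] [Fintype B] (Φ : LMap A B) : Prop where
  cp : IsCP Φ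
  trace_map : ∀ X : Matrix A A ℂ, (Φ X).trace = X.trace

/-- The order on linear maps: `Φ ≤ Ψ` means that `Ψ - Φ` is completely positive. -/
def CPLe {A B : Type*} (Φ Ψ : LMap A B) : Prop := IsCP (Ψ - Φ)

/-- The trace norm `‖X‖₁ = Tr |X|`, with `|X| = √(X† X)`. -/
def traceNorm {n : Type*} [Fintype n] [DecidableEq n] (X : Matrix n n ℂ) : ℝ :=
  (CFC.abs X).trace.re

/-- The operator norm `‖X‖_∞`, with respect to the Euclidean norm on `ℂ^n`. -/
def opNorm {n : Type*} [Fintype n] [DecidableEq n] (X : Matrix n n ℂ) : ℝ :=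
  ‖Matrix.toEuclideanCLM (n := n) (𝕜 := ℂ) X‖

/-- The diamond norm (completely bounded trace norm): the supremum of `‖(id_k ⊗ Φ)(X)‖₁` over all
`k` and all operators `X` on `ℂ^k ⊗ ℂ^A` with `‖X‖₁ ≤ 1`. -/
def diamondNorm {A B : Type*} [Fintype A] [DecidableEq A] [Fintype B] [DecidableEq B]
    (Φ : LMap A B) : ℝ :=
  sSup {r : ℝ | ∃ (k : ℕ) (X : Matrix (Fin k × A) (Fin k × A) ℂ),
    traceNorm X ≤ 1 ∧ r = traceNorm (ampliate (Fin k) Φ X)}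

/-- The Choi matrix `J^Φ_{AB} = ∑_{x,y} |x⟩⟨y| ⊗ Φ(|x⟩⟨y|)`. -/
def choi {A B : Type*} [Fintype A] [DecidableEq A] (Φ : LMap A B) :
    Matrix (A × B) (A × B) ℂ :=
  ∑ x : A, ∑ y : A,
    Matrix.kroneckerMap (· * ·) (Matrix.single x y (1 : ℂ)) (Φ (Matrix.single x y (1 : ℂ)))

/-- The marginal `ω_A = Tr_B ω_{AB}`. -/
def marginal {A B : Type*} [Fintype B] (ω : Matrix (A × B) (A × B) ℂ) : Matrix A A ℂ :=
  Matrix.of fun x y => ∑ b : B, ω (x, b) (y, b)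

/-- The max relative entropy of linear maps, `D_max(Φ‖Ψ) = log₂ min {t ≥ 0 : t Ψ ≥ Φ}`; it is
`+∞` if there is no such `t`, and `-∞` if `t = 0` is possible. -/
def dMax {A B : Type*} (Φ Ψ : LMap A B) : EReal :=
  ENNReal.log (sInf {s : ℝ≥0∞ | ∃ t : ℝ≥0, s = (t : ℝ≥0∞) ∧ CPLe Φ ((t : ℝ) • Ψ)})
    / ((Real.log 2 : ℝ) : EReal)

/-- `2 ^ x` for an extended real `x`, with `2 ^ (-∞) = 0` and `2 ^ (+∞) = +∞`. -/
def twoPow (x : EReal) : ℝ≥0∞ := EReal.exp (((Real.log 2 : ℝ) : EReal) * x)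

/-- The logarithmic robustness with respect to the set of all channels: the minimum of
`D_max(Φ‖E)` over `E ∈ CPTP(A → B)`. -/
def logRobustnessCPTP {A B : Type*} [Fintype A] [Fintype B] (Φ : LMap A B) : EReal :=
  sInf {d : EReal | ∃ E : LMap A B, IsCPTP E ∧ d = dMax Φ E}

end QChannel

end

/-! The proof is semidefinite duality on Choi matrices. Write `J` for the Choi matrix of `N - M`; it
is Hermitian, and its marginal on `A` vanishes because both channels preserve the trace.

Upper bound on the diamond norm (`traceNorm_ampliate_le`): if `ω ≥ 0` and `ω ≥ J`, then `N - M` is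
the difference of the completely positive maps with Choi matrices `ω` and `ω - J`, which have the
same marginal `ω_A`. An operator `X` is the corner of a positive block matrix whose diagonal blocks
have trace `‖X‖₁`. Applying both maps, with a sign flip on the off-diagonal blocks of the second,
and adding gives a positive block matrix with corner `(id ⊗ (N - M))(X)` and diagonal traces at most
`2‖ω_A‖‖X‖₁`.

Attainment (`exists_dominating`): let `D` be half the diamond norm. If no feasible `ω` had `ω_A ≤
D`, Hahn-Banach would give a faithful state `ρ` with `Tr ρ ω_A > D` for every feasible `ω`. Feed the
purification of `ρ` to `id ⊗ (N - M)`. The output is Hermitian and traceless with trace norm at most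
`2D`, so its positive part has trace at most `D`. Undoing the purification turns this positive part
into a feasible `ω` with `Tr ρ ω_A ≤ D`, a contradiction.

The channel forms follow by filling `ω_A` up to `D` with a multiple of the identity on `B`
(`exists_isCPTP_of_dominating`). Conversely, `λ J^E` is feasible with marginal `λ`. -/

noncomputable section

namespace QChannel

open scoped Kronecker
open Matrix

/-! ### Choi correspondence: complete positivity and trace preservation. -/

section Choi

variable {A B R K : Type*} [Fintype A] [DecidableEq A]

theorem choi_apply (Φ : LMap A B) (x y : A) (b c : B) :
    choi Φ (x, b) (y, c) = Φ (Matrix.single x y 1) b c := by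
  simp only [choi, Matrix.sum_apply, Matrix.kroneckerMap_apply, Matrix.single_apply]
  rw [Finset.sum_eq_single x, Finset.sum_eq_single y]
  · simp
  · intro z _ hz; simp [hz]
  · simp
  · intro z _ hz; simp [hz]
  · simp

theorem apply_eq_sum_choi (Φ : LMap A B) (Z : Matrix A A ℂ) (b c : B) :
    Φ Z b c = ∑ x, ∑ y, Z x y * choi Φ (x, b) (y, c) := by
  conv_lhs => rw [Matrix.matrix_eq_sum_single Z]
  simp only [map_sum, Matrix.sum_apply, choi_apply]
  refine Finset.sum_congr rfl fun x _ => Finset.sum_congr rfl fun y _ => ?_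
  have : Matrix.single x y (Z x y) = Z x y • Matrix.single x y (1 : ℂ) := by
    simp [Matrix.smul_single]
  rw [this, map_smul]
  simp

theorem choi_sub (Φ Ψ : LMap A B) : choi (Φ - Ψ) = choi Φ - choi Ψ := by
  ext ⟨x, b⟩ ⟨y, c⟩
  simp [choi_apply]

theorem choi_smul (r : ℝ) (Φ : LMap A B) : choi (r • Φ) = r • choi Φ := by
  ext ⟨x, b⟩ ⟨y, c⟩
  simp [choi_apply]

/-- The linear map with a given Choi matrix. -/
def ofChoi (ω : Matrix (A × B) (A × B) ℂ) : LMap A B where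
  toFun Z := Matrix.of fun b c => ∑ x, ∑ y, Z x y * ω (x, b) (y, c)
  map_add' Z Z' := by
    ext b c
    simp [add_mul, Finset.sum_add_distrib]
  map_smul' r Z := by
    ext b c
    simp [Finset.mul_sum, mul_assoc]

theorem choi_ofChoi (ω : Matrix (A × B) (A × B) ℂ) : choi (ofChoi ω) = ω := by
  ext ⟨x, b⟩ ⟨y, c⟩
  rw [choi_apply]
  simp only [ofChoi, LinearMap.coe_mk, AddHom.coe_mk, Matrix.of_apply, Matrix.single_apply]
  rw [Finset.sum_eq_single x, Finset.sum_eq_single y]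
  · simp
  · intro z _ hz; simp [hz.symm]
  · simp
  · intro z _ hz; simp [hz.symm]
  · simp

theorem ampliate_apply (Φ : LMap A B) (X : Matrix (R × A) (R × A) ℂ) (i j : R) (b c : B) :
    ampliate R Φ X (i, b) (j, c) = ∑ x, ∑ y, X (i, x) (j, y) * choi Φ (x, b) (y, c) := by
  simp [ampliate, apply_eq_sum_choi]

variable [Fintype B]

theorem trace_apply_eq (Φ : LMap A B) (Z : Matrix A A ℂ) :
    (Φ Z).trace = (Z * (marginal (choi Φ))ᵀ).trace := by
  simp only [Matrix.trace, Matrix.diag, Matrix.mul_apply, apply_eq_sum_choi Φ Z, marginal,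
    Matrix.transpose_apply, Matrix.of_apply, Finset.mul_sum]
  rw [Finset.sum_comm]
  exact Finset.sum_congr rfl fun x _ => Finset.sum_comm

theorem trace_ampliate [Fintype R] (Φ : LMap A B) (X : Matrix (R × A) (R × A) ℂ) :
    (ampliate R Φ X).trace =
      ((∑ i : R, X.submatrix (Prod.mk i) (Prod.mk i)) * (marginal (choi Φ))ᵀ).trace := by
  rw [Matrix.sum_mul, Matrix.trace_sum]
  simp only [← trace_apply_eq]
  simp only [Matrix.trace, Fintype.sum_prod_type]
  rfl

variable [DecidableEq B]

/-- A map with positive semidefinite Choi matrix preserves positivity on every extension. -/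
theorem ampliate_posSemidef [Fintype R] {Φ : LMap A B} (hΦ : (choi Φ).PosSemidef)
    {X : Matrix (R × A) (R × A) ℂ} (hX : X.PosSemidef) : (ampliate R Φ X).PosSemidef := by
  classical
  obtain ⟨K, hK⟩ := CStarAlgebra.nonneg_iff_eq_star_mul_self.mp hΦ.nonneg
  -- Kraus form: each row of the factor `K` in `choi Φ = K† K`, conjugated and reshaped, is a Kraus
  -- operator.
  have h : ampliate R Φ X = ∑ m, ((1 : Matrix R R ℂ) ⊗ₖ (Matrix.of fun b x => star (K m (x, b)))) *
      X * ((1 : Matrix R R ℂ) ⊗ₖ (Matrix.of fun b x => star (K m (x, b))))ᴴ := by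
    ext ⟨i, b⟩ ⟨j, c⟩
    rw [ampliate_apply, hK]
    simp only [Matrix.sum_apply, Matrix.mul_apply, Fintype.sum_prod_type,
      Matrix.kroneckerMap_apply, Matrix.conjTranspose_apply, Matrix.one_apply, Matrix.of_apply,
      Matrix.star_apply, ite_mul, one_mul, zero_mul, RCLike.star_def]
    simp only [apply_ite (starRingEnd ℂ), map_zero, mul_ite, mul_zero,
      Finset.sum_ite_eq, Finset.mem_univ, if_true, Complex.conj_conj,
      Finset.sum_ite_irrel, Finset.sum_const_zero, Finset.mul_sum, Finset.sum_mul]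
    have h (F : A → A → A → B → ℂ) : ∑ x, ∑ y, ∑ m, ∑ l, F x y m l =
        ∑ m, ∑ l, ∑ x, ∑ y, F x y m l := by
      simpa only [Fintype.sum_prod_type] using
        (Finset.sum_comm : ∑ p : A × A, ∑ m : A × B, F p.1 p.2 m.1 m.2 = _)
    rw [h]
    refine Finset.sum_congr rfl fun m _ => Finset.sum_congr rfl fun l _ => ?_
    rw [Finset.sum_comm]
    exact Finset.sum_congr rfl fun y _ => Finset.sum_congr rfl fun x _ => by ring
  rw [h]
  exact Matrix.posSemidef_sum _ fun m _ => hX.mul_mul_conjTranspose_same _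

/-- A vector of `R ⊗ A` is `M ⊗ 1` applied to the unnormalised maximally entangled vector, on which
`id ⊗ Φ` gives the Choi matrix. -/
theorem ampliate_vecMulVec (M : Matrix R A ℂ) (Φ : LMap A B) :
    ampliate R Φ (vecMulVec (fun p => M p.1 p.2) (star fun p => M p.1 p.2)) =
      (M ⊗ₖ (1 : Matrix B B ℂ)) * choi Φ * (M ⊗ₖ (1 : Matrix B B ℂ))ᴴ := by
  ext ⟨i, b⟩ ⟨j, c⟩
  rw [ampliate_apply]
  simp only [Matrix.mul_apply, Fintype.sum_prod_type,
    Matrix.kroneckerMap_apply, Matrix.conjTranspose_apply, Matrix.one_apply, vecMulVec_apply,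
    Pi.star_apply, mul_ite, mul_one, mul_zero, ite_mul, zero_mul, apply_ite star,
    star_zero, Finset.sum_ite_eq, Finset.mem_univ, if_true, Finset.sum_mul]
  rw [Finset.sum_comm]
  exact Finset.sum_congr rfl fun y _ => Finset.sum_congr rfl fun x _ => by ring

/-- A left inverse of `M` recovers the Choi matrix from the output on the vector of `M`. -/
theorem kronecker_one_mul_conj [Fintype R] {M : Matrix R A ℂ} {C : Matrix A R ℂ} (h : C * M = 1)
    (J : Matrix (A × B) (A × B) ℂ) :
    (C ⊗ₖ (1 : Matrix B B ℂ)) * ((M ⊗ₖ (1 : Matrix B B ℂ)) * J * (M ⊗ₖ (1 : Matrix B B ℂ))ᴴ) *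
      (C ⊗ₖ (1 : Matrix B B ℂ))ᴴ = J := by
  have h1 : (C ⊗ₖ (1 : Matrix B B ℂ)) * (M ⊗ₖ (1 : Matrix B B ℂ)) = 1 := by
    rw [← Matrix.mul_kronecker_mul, h, Matrix.one_mul, Matrix.one_kronecker_one]
  calc _ = ((C ⊗ₖ (1 : Matrix B B ℂ)) * (M ⊗ₖ (1 : Matrix B B ℂ))) * J *
        ((C ⊗ₖ (1 : Matrix B B ℂ)) * (M ⊗ₖ (1 : Matrix B B ℂ)))ᴴ := by
        rw [Matrix.conjTranspose_mul]; simp only [Matrix.mul_assoc]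
    _ = J := by rw [h1]; simp

/-- Testing on the maximally entangled vector suffices. The reference system must be some `Fin k`,
so `A` is relabelled by `Fin (card A)` and the relabelling is undone afterwards. -/
theorem isCP_iff_choi_posSemidef (Φ : LMap A B) : IsCP Φ ↔ (choi Φ).PosSemidef := by
  refine ⟨fun h => ?_, fun h k X hX => ampliate_posSemidef h hX⟩
  have e := (Fintype.equivFin A).symm
  have h1 := h _ _ (posSemidef_vecMulVec_self_star
    (fun p : Fin (Fintype.card A) × A => (1 : Matrix A A ℂ).submatrix e id p.1 p.2))
  rw [ampliate_vecMulVec] at h1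
  have h2 := h1.mul_mul_conjTranspose_same ((1 : Matrix A A ℂ).submatrix id e ⊗ₖ (1 : Matrix B B ℂ))
  rwa [kronecker_one_mul_conj] at h2
  rw [Matrix.submatrix_mul_equiv]
  simp

theorem isCPTP_iff_choi (Φ : LMap A B) :
    IsCPTP Φ ↔ (choi Φ).PosSemidef ∧ marginal (choi Φ) = 1 := by
  constructor
  · intro h
    refine ⟨(isCP_iff_choi_posSemidef Φ).1 h.cp, ?_⟩
    ext x y
    have h1 := h.trace_map (Matrix.single x y 1)
    rw [trace_apply_eq, Matrix.trace_single_mul] at h1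
    rw [Matrix.one_apply]
    simpa [Matrix.trace_single_eq_same, Matrix.trace, Matrix.diag, Matrix.single_apply, eq_comm,
      ite_and] using h1
  · rintro ⟨h1, h2⟩
    refine ⟨(isCP_iff_choi_posSemidef Φ).2 h1, fun X => ?_⟩
    rw [trace_apply_eq, h2]
    simp

end Choi

/-! ### Trace norm, polar decomposition and positive block matrices. -/

section TraceNorm

variable {n : Type*} [Fintype n]

theorem trace_mul_nonneg {P Q : Matrix n n ℂ} (hP : P.PosSemidef) (hQ : Q.PosSemidef) :
    0 ≤ (P * Q).trace := by
  classical
  obtain ⟨K, rfl⟩ := CStarAlgebra.nonneg_iff_eq_star_mul_self.mp hP.nonneg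
  rw [Matrix.mul_assoc, Matrix.trace_mul_comm]
  exact (hQ.mul_mul_conjTranspose_same K).trace_nonneg

variable [DecidableEq n]

/-- Polar decomposition with a partial isometry. -/
theorem exists_polar (X : Matrix n n ℂ) : ∃ W : Matrix n n ℂ,
    W * CFC.abs X = X ∧ Wᴴ * W * CFC.abs X = CFC.abs X ∧ W * Wᴴ * W = W := by
  set T := CFC.abs X with hT
  have hT0 : IsSelfAdjoint T := (CFC.abs_nonneg X).isSelfAdjoint
  have hTT : T * T = Xᴴ * X := CFC.abs_mul_abs X
  have hc : ∀ f : ℝ → ℝ, ContinuousOn f (spectrum ℝ T) := fun f =>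
    (Matrix.finite_real_spectrum).continuousOn f
  -- Since `0⁻¹ = 0`, `G` is the pseudo-inverse of `|X|`, and `W = X G` is the partial isometry.
  set G := cfc (fun t : ℝ => t⁻¹) T with hG
  have hGs : Gᴴ = G := (cfc_predicate (fun t : ℝ => t⁻¹) T : IsSelfAdjoint G)
  have hid : cfc (fun t : ℝ => t) T = T := cfc_id' ℝ T
  have hTG : T * G = G * T := by
    conv_lhs => rw [← hid]
    conv_rhs => rw [← hid]
    rw [hG, ← cfc_mul _ _ T (hc _) (hc _), ← cfc_mul _ _ T (hc _) (hc _)]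
    exact cfc_congr fun t _ => mul_comm _ _
  have hTGT : T * G * T = T := by
    conv_lhs => rw [← hid]
    conv_rhs => rw [← hid]
    rw [hG, ← cfc_mul _ _ T (hc _) (hc _), ← cfc_mul _ _ T (hc _) (hc _)]
    exact cfc_congr fun t _ => mul_inv_mul_cancel t
  have hGTG : G * T * G = G := by
    conv_lhs => rw [← hid]
    rw [hG, ← cfc_mul _ _ T (hc _) (hc _), ← cfc_mul _ _ T (hc _) (hc _)]
    exact cfc_congr fun t _ => by simpa using mul_inv_mul_cancel t⁻¹
  have hWW : (X * G)ᴴ * (X * G) = G * T := by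
    rw [Matrix.conjTranspose_mul, hGs]
    calc G * Xᴴ * (X * G) = G * (Xᴴ * X) * G := by simp only [Matrix.mul_assoc]
      _ = (G * T) * (T * G) := by rw [← hTT]; simp only [Matrix.mul_assoc]
      _ = G * (T * (G * T)) := by rw [hTG, Matrix.mul_assoc]
      _ = G * T := by rw [← Matrix.mul_assoc T, hTGT]
  refine ⟨X * G, ?_, ?_, ?_⟩
  · have h : (X * G * T - X)ᴴ * (X * G * T - X) = 0 := by
      have h1 : X * G * T - X = X * (G * T - 1) := by
        rw [Matrix.mul_sub, Matrix.mul_one, Matrix.mul_assoc]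
      have h2 : T * (G * T - 1) = 0 := by
        rw [Matrix.mul_sub, Matrix.mul_one, ← Matrix.mul_assoc, hTGT, sub_self]
      rw [h1, Matrix.conjTranspose_mul]
      calc _ = (G * T - 1)ᴴ * (Xᴴ * X) * (G * T - 1) := by simp only [Matrix.mul_assoc]
        _ = (G * T - 1)ᴴ * T * (T * (G * T - 1)) := by rw [← hTT]; simp only [Matrix.mul_assoc]
        _ = 0 := by rw [h2, Matrix.mul_zero]
    exact sub_eq_zero.1 (Matrix.conjTranspose_mul_self_eq_zero.1 h)
  · rw [hWW, ← hTG, hTGT]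
  · rw [Matrix.mul_assoc _ _ (X * G), hWW, Matrix.mul_assoc, ← hTG, ← Matrix.mul_assoc G,
      hGTG]

/-- Every square matrix is the corner of a positive block matrix whose diagonal blocks have trace
equal to its trace norm. -/
theorem exists_posSemidef_fromBlocks (X : Matrix n n ℂ) : ∃ P Q : Matrix n n ℂ,
    (fromBlocks P X Xᴴ Q).PosSemidef ∧ P.trace.re = traceNorm X ∧ Q.trace.re = traceNorm X := by
  obtain ⟨W, h1, h2, -⟩ := exists_polar X
  have hT : (CFC.abs X).PosSemidef := (CFC.abs_nonneg X).posSemidef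
  -- The block matrix is `|X|` conjugated by the column `(W, 1)`.
  refine ⟨W * CFC.abs X * Wᴴ, CFC.abs X, ?_, ?_, rfl⟩
  · have h := hT.mul_mul_conjTranspose_same (fromRows W (1 : Matrix n n ℂ))
    have h3 : CFC.abs X * Wᴴ = Xᴴ := by
      conv_rhs => rw [← h1, Matrix.conjTranspose_mul, hT.isHermitian.eq]
    rw [Matrix.conjTranspose_fromRows_eq_fromCols_conjTranspose, Matrix.fromRows_mul,
      Matrix.fromRows_mul_fromCols] at h
    simpa [h1, h3] using h
  · rw [Matrix.trace_mul_comm, ← Matrix.mul_assoc, h2]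
    rfl

/-- The trace norm of an off-diagonal block of a positive block matrix is at most half the
trace. -/
theorem traceNorm_le_of_posSemidef_fromBlocks {P Y Y' Q : Matrix n n ℂ}
    (h : (fromBlocks P Y Y' Q).PosSemidef) : traceNorm Y ≤ (P.trace.re + Q.trace.re) / 2 := by
  obtain ⟨W, h1, h2, h3⟩ := exists_polar Y
  have hY' : Y' = Yᴴ := by
    have h4 := h.isHermitian.eq
    rw [Matrix.fromBlocks_conjTranspose, Matrix.fromBlocks_inj] at h4
    exact h4.2.2.1.symm
  have hP : P.PosSemidef := h.submatrix Sum.inl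
  have hproj : (1 - W * Wᴴ).PosSemidef := by
    have h5 := posSemidef_conjTranspose_mul_self (1 - W * Wᴴ)
    have h6 : (1 - W * Wᴴ)ᴴ * (1 - W * Wᴴ) = 1 - W * Wᴴ := by
      simp only [Matrix.conjTranspose_sub, Matrix.conjTranspose_one, Matrix.conjTranspose_mul,
        Matrix.conjTranspose_conjTranspose, Matrix.sub_mul, Matrix.mul_sub, Matrix.one_mul,
        Matrix.mul_one]
      rw [← Matrix.mul_assoc, h3]
      simp
    rwa [h6] at h5
  have h7 : 0 ≤ (P * (1 - W * Wᴴ)).trace.re := (Complex.le_def.1 (trace_mul_nonneg hP hproj)).1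
  have h8 : (Wᴴ * Y).trace.re = traceNorm Y := by
    conv_lhs => rw [← h1, ← Matrix.mul_assoc, h2]
    rfl
  have h9 : (Yᴴ * W).trace.re = traceNorm Y := by
    rw [← h8, ← Complex.conj_re, starRingEnd_apply, ← Matrix.trace_conjTranspose]
    simp
  -- Compressing by the column `(W, -1)` gives `0 ≤ Tr (P W W†) - 2‖Y‖₁ + Tr Q`, and `W W†` is a
  -- projection, so the first term is at most `Tr P`.
  have h10 := (Complex.le_def.1
    (h.conjTranspose_mul_mul_same (fromRows W (-1 : Matrix n n ℂ))).trace_nonneg).1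
  rw [Matrix.conjTranspose_fromRows_eq_fromCols_conjTranspose, Matrix.mul_assoc,
    Matrix.fromBlocks_mul_fromRows, Matrix.fromCols_mul_fromRows, hY'] at h10
  have h11 : (Wᴴ * (P * W)).trace = (P * (W * Wᴴ)).trace := by
    rw [Matrix.trace_mul_comm, Matrix.mul_assoc]
  simp only [Matrix.mul_neg, Matrix.mul_one, Matrix.conjTranspose_neg, Matrix.conjTranspose_one,
    Matrix.mul_add, Matrix.neg_mul, Matrix.one_mul, Matrix.trace_add, Matrix.trace_neg, h11,
    Complex.add_re, Complex.neg_re, h8, h9, Complex.zero_re] at h10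
  simp only [Matrix.mul_sub, Matrix.mul_one, Matrix.trace_sub, Complex.sub_re] at h7
  linarith

theorem traceNorm_of_posSemidef {X : Matrix n n ℂ} (hX : X.PosSemidef) :
    traceNorm X = X.trace.re := by
  rw [traceNorm, CFC.abs_of_nonneg X hX.nonneg]

/-- A Hermitian matrix is dominated by a positive one of trace `(‖Y‖₁ + Tr Y) / 2`. -/
theorem exists_posSemidef_ge {Y : Matrix n n ℂ} (hY : Y.IsHermitian) :
    ∃ P : Matrix n n ℂ, P.PosSemidef ∧ (P - Y).PosSemidef ∧
      P.trace.re = (traceNorm Y + Y.trace.re) / 2 := by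
  have hY' : IsSelfAdjoint Y := hY
  -- The positive part is `(|Y| + Y) / 2`.
  refine ⟨Y⁺, (CFC.posPart_nonneg Y).posSemidef, CFC.le_posPart hY', ?_⟩
  have h := congrArg (fun Z => (Matrix.trace Z).re) (CFC.abs_add_self Y hY')
  simp only [Matrix.trace_add, Complex.add_re, two_smul] at h
  rw [traceNorm]
  linarith

end TraceNorm

/-! ### Operator norm of positive matrices. -/

section OpNorm

open scoped Matrix.Norms.L2Operator

variable {n : Type*} [Fintype n] [DecidableEq n]

theorem opNorm_le_iff {H : Matrix n n ℂ} (hH : H.PosSemidef) {c : ℝ} (hc : 0 ≤ c) :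
    opNorm H ≤ c ↔ (c • (1 : Matrix n n ℂ) - H).PosSemidef := by
  rw [opNorm, ← Matrix.cstar_norm_def, CStarAlgebra.norm_le_iff_le_algebraMap H hc hH.nonneg,
    Algebra.algebraMap_eq_smul_one]
  rfl

theorem opNorm_nonneg (H : Matrix n n ℂ) : 0 ≤ opNorm H := norm_nonneg _

theorem opNorm_smul_one [Nonempty n] {c : ℝ} (hc : 0 ≤ c) :
    opNorm (c • (1 : Matrix n n ℂ)) = c := by
  rw [opNorm, ← Matrix.cstar_norm_def, norm_smul, norm_one, Real.norm_of_nonneg hc, mul_one]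

end OpNorm

/-! ### Partial trace over `B`. -/

section Marginal

variable {A B : Type*} [Fintype B]

theorem marginal_sub (ω τ : Matrix (A × B) (A × B) ℂ) :
    marginal (ω - τ) = marginal ω - marginal τ := by
  ext x y
  simp [marginal]

theorem marginal_add (ω τ : Matrix (A × B) (A × B) ℂ) :
    marginal (ω + τ) = marginal ω + marginal τ := by
  ext x y
  simp [marginal, Finset.sum_add_distrib]

theorem marginal_smul (r : ℝ) (ω : Matrix (A × B) (A × B) ℂ) :
    marginal (r • ω) = r • marginal ω := by
  ext x y
  simp [marginal, Finset.smul_sum]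

theorem marginal_posSemidef [Fintype A] {ω : Matrix (A × B) (A × B) ℂ} (hω : ω.PosSemidef) :
    (marginal ω).PosSemidef := by
  have h : marginal ω = ∑ b : B, ω.submatrix (fun x => (x, b)) (fun x => (x, b)) := by
    ext x y
    simp [marginal, Matrix.sum_apply]
  rw [h]
  exact Matrix.posSemidef_sum _ fun b _ => hω.submatrix _

theorem trace_marginal [Fintype A] (ω : Matrix (A × B) (A × B) ℂ) :
    (marginal ω).trace = ω.trace := by
  simp [marginal, Matrix.trace, Fintype.sum_prod_type]

theorem trace_mul_marginal [Fintype A] [DecidableEq B] (ρ : Matrix A A ℂ)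
    (ω : Matrix (A × B) (A × B) ℂ) :
    (ρ * marginal ω).trace = ((ρ ⊗ₖ (1 : Matrix B B ℂ)) * ω).trace := by
  simp only [Matrix.trace, Matrix.diag, Matrix.mul_apply, marginal, Matrix.of_apply,
    Fintype.sum_prod_type, Matrix.kroneckerMap_apply, Matrix.one_apply, mul_ite, mul_one, mul_zero,
    ite_mul, zero_mul, Finset.sum_ite_eq, Finset.mem_univ, if_true, Finset.mul_sum]
  exact Finset.sum_congr rfl fun x _ => Finset.sum_comm

theorem continuous_marginal :
    Continuous (marginal : Matrix (A × B) (A × B) ℂ → Matrix A A ℂ) := by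
  unfold marginal
  refine continuous_matrix fun x y => continuous_finsetSum _ fun b _ => ?_
  exact continuous_id.matrix_elem _ _

end Marginal

/-! ### Weak duality: feasible matrices bound the trace norm of outputs. -/

section WeakDuality

variable {A B R : Type*} [Fintype A] [DecidableEq A] [Fintype B] [Fintype R]

theorem trace_ampliate_le {Φ : LMap A B} {c : ℝ}
    (hc : (c • (1 : Matrix A A ℂ) - marginal (choi Φ)).PosSemidef)
    {P : Matrix (R × A) (R × A) ℂ} (hP : P.PosSemidef) :
    (ampliate R Φ P).trace.re ≤ c * P.trace.re := by
  have hS : (∑ i : R, P.submatrix (Prod.mk i) (Prod.mk i)).PosSemidef :=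
    Matrix.posSemidef_sum _ fun i _ => hP.submatrix _
  have hS' : (∑ i : R, P.submatrix (Prod.mk i) (Prod.mk i)).trace = P.trace := by
    rw [Matrix.trace_sum]
    simp [Matrix.trace, Fintype.sum_prod_type]
  have h := (Complex.le_def.1 (trace_mul_nonneg hS hc.transpose)).1
  rw [Matrix.transpose_sub, Matrix.mul_sub, Matrix.trace_sub, ← trace_ampliate,
    Matrix.transpose_smul, Matrix.transpose_one, Matrix.mul_smul, Matrix.mul_one,
    Matrix.trace_smul, hS'] at h
  simpa using h

variable [DecidableEq B]

theorem ampliate_fromBlocks_posSemidef {Φ : LMap A B} (hΦ : (choi Φ).PosSemidef)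
    {P X X' Q : Matrix (R × A) (R × A) ℂ} (h : (fromBlocks P X X' Q).PosSemidef) :
    (fromBlocks (ampliate R Φ P) (ampliate R Φ X) (ampliate R Φ X')
      (ampliate R Φ Q)).PosSemidef := by
  have h1 := (ampliate_posSemidef hΦ (h.submatrix (Equiv.sumProdDistrib R R A))).submatrix
    (Equiv.sumProdDistrib R R B).symm
  convert h1 using 1
  ext (⟨i, b⟩ | ⟨i, b⟩) (⟨j, c⟩ | ⟨j, c⟩) <;> rfl

theorem traceNorm_ampliate_le {Φ : LMap A B} (hm : marginal (choi Φ) = 0)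
    {ω : Matrix (A × B) (A × B) ℂ} (hω : ω.PosSemidef) (hωΦ : (ω - choi Φ).PosSemidef)
    {c : ℝ} (hc : (c • (1 : Matrix A A ℂ) - marginal ω).PosSemidef)
    (X : Matrix (R × A) (R × A) ℂ) [DecidableEq R] :
    traceNorm (ampliate R Φ X) ≤ 2 * c * traceNorm X := by
  obtain ⟨P, Q, hX, hP, hQ⟩ := exists_posSemidef_fromBlocks X
  have hsplit : ampliate R Φ X = ampliate R (ofChoi ω) X - ampliate R (ofChoi (ω - choi Φ)) X := by
    ext ⟨i, b⟩ ⟨j, d⟩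
    rw [Matrix.sub_apply]
    simp only [ampliate_apply, choi_ofChoi, Matrix.sub_apply, mul_sub, Finset.sum_sub_distrib]
    ring
  have hP0 : P.PosSemidef := hX.submatrix Sum.inl
  have hQ0 : Q.PosSemidef := hX.submatrix Sum.inr
  have h1 := ampliate_fromBlocks_posSemidef (Φ := ofChoi ω) (by rwa [choi_ofChoi]) hX
  -- Conjugation by `diag(1, -1)` negates the off-diagonal blocks only, so in the sum `h3` the
  -- corners subtract while the diagonal blocks add.
  have h2 := (ampliate_fromBlocks_posSemidef (Φ := ofChoi (ω - choi Φ))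
    (by rwa [choi_ofChoi]) hX).mul_mul_conjTranspose_same 
      (fromBlocks (1 : Matrix (R × B) (R × B) ℂ) 0 0 (-1 : Matrix (R × B) (R × B) ℂ))
  have h3 := h1.add h2
  simp only [Matrix.fromBlocks_multiply, Matrix.fromBlocks_conjTranspose,
    Matrix.fromBlocks_add, Matrix.one_mul, Matrix.zero_mul, Matrix.mul_one, Matrix.mul_zero,
    add_zero, zero_add, Matrix.conjTranspose_one, Matrix.conjTranspose_zero,
    Matrix.conjTranspose_neg, Matrix.mul_neg, Matrix.neg_mul, neg_neg] at h3
  rw [← sub_eq_add_neg, ← hsplit] at h3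
  have h4 := traceNorm_le_of_posSemidef_fromBlocks h3
  have hc1 : (c • (1 : Matrix A A ℂ) - marginal (choi (ofChoi ω))).PosSemidef := by
    rwa [choi_ofChoi]
  have hc2 : (c • (1 : Matrix A A ℂ) - marginal (choi (ofChoi (ω - choi Φ)))).PosSemidef := by
    rwa [choi_ofChoi, marginal_sub, hm, sub_zero]
  have b1 := trace_ampliate_le hc1 hP0
  have b2 := trace_ampliate_le hc1 hQ0
  have b3 := trace_ampliate_le hc2 hP0
  have b4 := trace_ampliate_le hc2 hQ0
  simp only [Matrix.trace_add, Complex.add_re] at h4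
  rw [hP] at b1 b3
  rw [hQ] at b2 b4
  linarith

end WeakDuality

/-! ### Compactness and separation for positive semidefinite matrices. -/

section Topology

open scoped Matrix.Norms.L2Operator

variable {n : Type*} [Fintype n] [DecidableEq n]

theorem isClosed_setOf_posSemidef : IsClosed {ω : Matrix n n ℂ | ω.PosSemidef} := by
  have h := CStarAlgebra.isClosed_nonneg (A := Matrix n n ℂ)
  simpa only [Matrix.nonneg_iff_posSemidef] using h

theorem norm_le_trace_of_posSemidef {ω : Matrix n n ℂ} (hω : ω.PosSemidef) :
    ‖ω‖ ≤ ω.trace.re := by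
  have h0 : 0 ≤ ω.trace.re := (Complex.le_def.1 hω.trace_nonneg).1
  rw [CStarAlgebra.norm_le_iff_le_algebraMap ω h0 hω.nonneg]
  refine le_algebraMap_of_spectrum_le (fun r hr => ?_) hω.isHermitian
  rw [hω.isHermitian.spectrum_real_eq_range_eigenvalues] at hr
  obtain ⟨i, rfl⟩ := hr
  rw [hω.isHermitian.trace_eq_sum_eigenvalues, Complex.re_sum]
  exact Finset.single_le_sum (f := fun i => hω.isHermitian.eigenvalues i)
    (fun j _ => hω.eigenvalues_nonneg j) (Finset.mem_univ i)

theorem isCompact_posSemidef_trace_le (T : ℝ) :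
    IsCompact {ω : Matrix n n ℂ | ω.PosSemidef ∧ ω.trace.re ≤ T} := by
  have : ProperSpace (Matrix n n ℂ) := FiniteDimensional.proper ℂ _
  refine Metric.isCompact_of_isClosed_isBounded ?_ ?_
  · have h : IsClosed {ω : Matrix n n ℂ | ω.trace.re ≤ T} :=
      isClosed_le (Complex.continuous_re.comp continuous_id.matrix_trace) continuous_const
    exact isClosed_setOf_posSemidef.inter h
  · refine isBounded_iff_forall_norm_le.2 ⟨T, fun ω hω => ?_⟩
    exact (norm_le_trace_of_posSemidef hω.1).trans hω.2

/-- Hahn-Banach separation of a Hermitian matrix from a closed convex set of matrices that is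
stable under adding positive semidefinite matrices. -/
theorem exists_posSemidef_separating {S : Set (Matrix n n ℂ)} (hconv : Convex ℝ S)
    (hclosed : IsClosed S) (hne : S.Nonempty) (hherm : ∀ H ∈ S, H.IsHermitian)
    (hup : ∀ H ∈ S, ∀ P : Matrix n n ℂ, P.PosSemidef → H + P ∈ S)
    {K : Matrix n n ℂ} (hK : K.IsHermitian) (hKS : K ∉ S) :
    ∃ (ρ : Matrix n n ℂ) (u : ℝ), ρ.PosSemidef ∧ (ρ * K).trace.re < u ∧
      ∀ H ∈ S, u < (ρ * H).trace.re := by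
  obtain ⟨f, u, hfK, hfS⟩ := RCLike.geometric_hahn_banach_point_closed (𝕜 := ℂ) hconv hclosed hKS
  set G : Matrix n n ℂ := Matrix.of fun x y => f (Matrix.single y x 1) with hG
  have hf (H : Matrix n n ℂ) : f H = (G * H).trace := by
    conv_lhs => rw [Matrix.matrix_eq_sum_single H]
    simp only [map_sum, Matrix.trace, Matrix.diag, Matrix.mul_apply, hG, Matrix.of_apply]
    rw [Finset.sum_comm]
    refine Finset.sum_congr rfl fun x _ => Finset.sum_congr rfl fun y _ => ?_
    have : Matrix.single y x (H y x) = H y x • Matrix.single y x (1 : ℂ) := by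
      simp [Matrix.smul_single]
    rw [this, map_smul, smul_eq_mul, mul_comm]
  -- On Hermitian matrices the real part of the functional sees only the Hermitian part of `G`.
  set ρ : Matrix n n ℂ := (1 / 2 : ℝ) • (G + Gᴴ) with hρ
  have hρH {H : Matrix n n ℂ} (hH : H.IsHermitian) : (ρ * H).trace.re = (f H).re := by
    have h1 : (Gᴴ * H).trace.re = (G * H).trace.re := by
      rw [← Complex.conj_re, starRingEnd_apply, ← Matrix.trace_conjTranspose,
        Matrix.conjTranspose_mul, Matrix.conjTranspose_conjTranspose, hH.eq, Matrix.trace_mul_comm]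
    rw [hρ, hf, Matrix.smul_mul, Matrix.trace_smul, Matrix.add_mul, Matrix.trace_add,
      Complex.smul_re, Complex.add_re, h1, smul_eq_mul]
    ring
  have hρh : ρ.IsHermitian := by
    rw [Matrix.IsHermitian, hρ, Matrix.conjTranspose_smul, Matrix.conjTranspose_add,
      Matrix.conjTranspose_conjTranspose, add_comm]
    simp
  refine ⟨ρ, u, PosSemidef.of_dotProduct_mulVec_nonneg hρh fun v => ?_, ?_, ?_⟩
  · have hP := posSemidef_vecMulVec_self_star v
    have h1 : star v ⬝ᵥ ρ *ᵥ v = (ρ * vecMulVec v (star v)).trace := by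
      rw [Matrix.mul_vecMulVec, Matrix.trace_vecMulVec, dotProduct_comm]
    have hre : 0 ≤ (f (vecMulVec v (star v))).re := by
      obtain ⟨H, hH⟩ := hne
      by_contra! hneg
      set a := (f (vecMulVec v (star v))).re with ha
      -- If the functional were negative on `v v†`, moving from `H` by this multiple of `v v†` would
      -- stay in `S` and bring its real part down to exactly `u`.
      have ht : 0 ≤ ((f H).re - u) / (-a) :=
        div_nonneg (sub_nonneg.2 (hfS H hH).le) (by linarith)
      have h2 := hfS _ (hup H hH _ (hP.smul ht))
      have h3 : (f ((((f H).re - u) / (-a)) • vecMulVec v (star v))).re =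
          (((f H).re - u) / (-a)) * a := by
        rw [← Complex.coe_smul, map_smul, smul_eq_mul, Complex.re_ofReal_mul]
      rw [map_add, RCLike.re_eq_complex_re, Complex.add_re, h3, div_mul_eq_mul_div, div_neg,
        mul_div_cancel_right₀ _ hneg.ne] at h2
      linarith
    have him : (star v ⬝ᵥ ρ *ᵥ v).im = 0 := by
      simpa using hρh.im_star_dotProduct_mulVec_self v
    rw [Complex.le_def]
    refine ⟨?_, by simpa using him.symm⟩
    rw [h1, hρH hP.isHermitian]
    simpa using hre
  · rw [hρH hK]; exact hfK
  · intro H hH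
    rw [hρH (hherm H hH)]
    exact hfS H hH

end Topology

/-! ### The convex set of upper marginals and a faithful separating state. -/

section Feasible

open scoped Matrix.Norms.L2Operator

variable {A B : Type*} [Fintype B]

/-- The matrices dominating the marginal of some `ω ≥ 0` with `ω ≥ J`. -/
def upperMarginals (J : Matrix (A × B) (A × B) ℂ) : Set (Matrix A A ℂ) :=
  {H | ∃ ω : Matrix (A × B) (A × B) ℂ,
    ω.PosSemidef ∧ (ω - J).PosSemidef ∧ (H - marginal ω).PosSemidef}

theorem convex_upperMarginals (J : Matrix (A × B) (A × B) ℂ) : Convex ℝ (upperMarginals J) := by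
  rintro H ⟨ω, h1, h2, h3⟩ H' ⟨ω', h1', h2', h3'⟩ a b ha hb hab
  refine ⟨a • ω + b • ω', (h1.smul ha).add (h1'.smul hb), ?_, ?_⟩
  · have h := (h2.smul ha).add (h2'.smul hb)
    have e : a • ω + b • ω' - J = a • (ω - J) + b • (ω' - J) := by
      conv_lhs => rw [← one_smul ℝ J, ← hab]
      module
    rwa [e]
  · have h := (h3.smul ha).add (h3'.smul hb)
    have e : a • H + b • H' - marginal (a • ω + b • ω') =
        a • (H - marginal ω) + b • (H' - marginal ω') := by
      rw [marginal_add, marginal_smul, marginal_smul]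
      module
    rwa [e]

variable [Fintype A]

theorem upperMarginals_posSemidef {J : Matrix (A × B) (A × B) ℂ} {H : Matrix A A ℂ}
    (hH : H ∈ upperMarginals J) : H.PosSemidef := by
  obtain ⟨ω, h1, -, h3⟩ := hH
  simpa using h3.add (marginal_posSemidef h1)

variable [DecidableEq A] [DecidableEq B]

/-- The trace of a witness `ω` is at most that of `H`, so the witnesses of a convergent sequence lie
in a compact set, and a limit point is a witness for the limit. -/
theorem isClosed_upperMarginals (J : Matrix (A × B) (A × B) ℂ) : IsClosed (upperMarginals J) := by
  refine IsSeqClosed.isClosed fun H L hH hL => ?_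
  choose ω h1 h2 h3 using hH
  have htr : Filter.Tendsto (fun k => (H k).trace.re) Filter.atTop (nhds L.trace.re) :=
    ((Complex.continuous_re.comp (continuous_id.matrix_trace)).tendsto L).comp hL
  obtain ⟨T, hT⟩ := htr.bddAbove_range
  have hmem (k) : ω k ∈ {ω : Matrix (A × B) (A × B) ℂ | ω.PosSemidef ∧ ω.trace.re ≤ T} := by
    refine ⟨h1 k, ?_⟩
    have h4 := (Complex.le_def.1 (h3 k).trace_nonneg).1
    rw [Matrix.trace_sub, trace_marginal, Complex.sub_re, Complex.zero_re] at h4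
    have h5 : (H k).trace.re ≤ T := hT ⟨k, rfl⟩
    linarith
  obtain ⟨τ, hτ, φ, hφ, hlim⟩ := (isCompact_posSemidef_trace_le T).tendsto_subseq hmem
  refine ⟨τ, hτ.1, ?_, ?_⟩
  · exact isClosed_setOf_posSemidef.mem_of_tendsto (hlim.sub_const J)
      (Filter.Eventually.of_forall fun k => h2 (φ k))
  · exact isClosed_setOf_posSemidef.mem_of_tendsto
      ((hL.comp hφ.tendsto_atTop).sub ((continuous_marginal.tendsto τ).comp hlim))
      (Filter.Eventually.of_forall fun k => h3 (φ k))

theorem exists_posDef_separating [Nonempty A] {J : Matrix (A × B) (A × B) ℂ}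
    (hJ : J.IsHermitian) {D : ℝ} (hDJ : D • (1 : Matrix A A ℂ) ∉ upperMarginals J) :
    ∃ ρ : Matrix A A ℂ, ρ.PosDef ∧ ρ.trace = 1 ∧
      ∀ ω : Matrix (A × B) (A × B) ℂ, ω.PosSemidef → (ω - J).PosSemidef →
        D < (ρ * marginal ω).trace.re := by
  have hne : (upperMarginals J).Nonempty := by
    obtain ⟨P, h1, h2, -⟩ := exists_posSemidef_ge hJ
    exact ⟨marginal P, P, h1, h2, by simpa using PosSemidef.zero⟩
  have hK : (D • (1 : Matrix A A ℂ)).IsHermitian := by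
    simp [Matrix.IsHermitian, Matrix.conjTranspose_smul]
  obtain ⟨ρ, u, hρ, hu, hS⟩ := exists_posSemidef_separating (convex_upperMarginals J)
    (isClosed_upperMarginals J) hne (fun H hH => (upperMarginals_posSemidef hH).isHermitian)
    (fun H ⟨ω, h1, h2, h3⟩ P hP => ⟨ω, h1, h2, by
      simpa [add_sub_right_comm] using h3.add hP⟩) hK hDJ
  -- Adding a small `ε • 1` makes `ρ` invertible while keeping the separation strict; on the
  -- feasible side it only increases the trace, as marginals are positive.
  obtain ⟨ε, hε, hε'⟩ : ∃ ε : ℝ, 0 < ε ∧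
      (ρ * (D • (1 : Matrix A A ℂ))).trace.re + ε * (D * Fintype.card A) < u := by
    have hc : Filter.Tendsto (fun ε : ℝ => (ρ * (D • (1 : Matrix A A ℂ))).trace.re +
        ε * (D * Fintype.card A)) (nhdsWithin 0 (Set.Ioi 0))
        (nhds ((ρ * (D • (1 : Matrix A A ℂ))).trace.re + 0 * (D * Fintype.card A))) :=
      (Continuous.tendsto (by fun_prop) 0).mono_left nhdsWithin_le_nhds
    rw [zero_mul, add_zero] at hc
    obtain ⟨ε, h1, h2⟩ := ((hc.eventually_lt_const hu).and self_mem_nhdsWithin).exists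
    exact ⟨ε, h2, h1⟩
  set σ : Matrix A A ℂ := ρ + ε • (1 : Matrix A A ℂ) with hσ
  have hσp : σ.PosDef := PosDef.posSemidef_add hρ (PosDef.one.smul hε)
  set t := σ.trace.re with ht
  have htr : σ.trace = (t : ℂ) := by
    have h := Complex.le_def.1 hσp.posSemidef.trace_nonneg
    exact Complex.ext (by simp [ht]) (by simpa using h.2.symm)
  have htpos : 0 < t := (Complex.lt_def.1 hσp.trace_pos).1
  refine ⟨t⁻¹ • σ, hσp.smul (inv_pos.2 htpos), ?_, fun ω h1 h2 => ?_⟩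
  · rw [Matrix.trace_smul, htr, Complex.real_smul, ← Complex.ofReal_mul, inv_mul_cancel₀ htpos.ne',
      Complex.ofReal_one]
  · have h3 := hS (marginal ω) ⟨ω, h1, h2, by simpa using PosSemidef.zero⟩
    have h4 : 0 ≤ (marginal ω).trace.re :=
      (Complex.le_def.1 (marginal_posSemidef h1).trace_nonneg).1
    have h5 : D * t < u := by
      refine lt_of_eq_of_lt ?_ hε'
      rw [ht, hσ, Matrix.trace_add, Matrix.trace_smul, Matrix.trace_one, Matrix.mul_smul,
        Matrix.mul_one, Matrix.trace_smul]
      simp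
      ring
    have h6 : (σ * marginal ω).trace.re = (ρ * marginal ω).trace.re + ε * (marginal ω).trace.re := by
      rw [hσ, Matrix.add_mul, Matrix.trace_add, Matrix.smul_mul, Matrix.one_mul,
        Matrix.trace_smul]
      simp
    rw [Matrix.smul_mul, Matrix.trace_smul, Complex.smul_re, smul_eq_mul, h6, inv_mul_eq_div,
      lt_div_iff₀ htpos]
    have := mul_nonneg hε.le h4
    linarith

end Feasible

/-! ### Strong duality through purification of the separating state. -/

section StrongDuality

variable {A B : Type*} [Fintype A] [DecidableEq A] [Nonempty A] [Fintype B] [DecidableEq B]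

theorem exists_dominating {Φ : LMap A B} (hJ : (choi Φ).IsHermitian)
    (hm : marginal (choi Φ) = 0) {D : ℝ}
    (hb : ∀ (k : ℕ) (X : Matrix (Fin k × A) (Fin k × A) ℂ), traceNorm X ≤ 1 →
      traceNorm (ampliate (Fin k) Φ X) ≤ 2 * D) :
    ∃ ω : Matrix (A × B) (A × B) ℂ, ω.PosSemidef ∧ (ω - choi Φ).PosSemidef ∧
      (D • (1 : Matrix A A ℂ) - marginal ω).PosSemidef := by
  by_contra hcon
  obtain ⟨ρ, hρ, htr, hsep⟩ := exists_posDef_separating hJ hcon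
  obtain ⟨K, hK⟩ := CStarAlgebra.nonneg_iff_eq_star_mul_self.mp hρ.posSemidef.nonneg
  have e := (Fintype.equivFin A).symm
  -- `M` is an invertible factor with `M† M = ρ`, so the vector `v` below is a unit vector with `M`
  -- as its coefficient matrix.
  set M : Matrix (Fin (Fintype.card A)) A ℂ := K.submatrix e id with hM
  have hMM : Mᴴ * M = ρ := by
    rw [hM, Matrix.conjTranspose_submatrix, Matrix.submatrix_mul_equiv, hK]
    simp [Matrix.star_eq_conjTranspose]
  set C : Matrix A (Fin (Fintype.card A)) ℂ := ρ⁻¹ * Mᴴ with hC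
  have hCM : C * M = 1 := by
    rw [hC, Matrix.mul_assoc, hMM]
    exact Matrix.nonsing_inv_mul _ ((Matrix.isUnit_iff_isUnit_det _).1 hρ.isUnit)
  have hMC : M * C = 1 := (Matrix.mul_eq_one_comm_of_equiv e.symm).1 hCM
  set v : Fin (Fintype.card A) × A → ℂ := fun p => M p.1 p.2 with hv
  have hX := posSemidef_vecMulVec_self_star v
  have hXt : (vecMulVec v (star v)).trace = 1 := by
    rw [← htr, ← hMM, Matrix.trace_vecMulVec]
    simp only [dotProduct, Fintype.sum_prod_type, Matrix.trace, Matrix.diag, Matrix.mul_apply,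
      Matrix.conjTranspose_apply, Pi.star_apply, hv]
    rw [Finset.sum_comm]
    exact Finset.sum_congr rfl fun x _ => Finset.sum_congr rfl fun i _ => mul_comm _ _
  have hbound := hb _ (vecMulVec v (star v)) (by
    rw [traceNorm_of_posSemidef hX, hXt, Complex.one_re])
  have hYt : (ampliate (Fin (Fintype.card A)) Φ (vecMulVec v (star v))).trace = 0 := by
    rw [trace_ampliate, hm]
    simp
  have hYe := ampliate_vecMulVec M Φ
  rw [← hv] at hYe
  set Y := ampliate (Fin (Fintype.card A)) Φ (vecMulVec v (star v)) with hY
  have hYh : Y.IsHermitian := by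
    rw [hYe]
    exact Matrix.isHermitian_mul_mul_conjTranspose _ hJ
  obtain ⟨P, hP, hPY, hPt⟩ := exists_posSemidef_ge hYh
  have h1 := hPY.mul_mul_conjTranspose_same (C ⊗ₖ (1 : Matrix B B ℂ))
  rw [Matrix.mul_sub, Matrix.sub_mul, hYe, kronecker_one_mul_conj hCM] at h1
  -- The feasible matrix is `P` pulled back by `C = M⁻¹`; by `h3` below, its marginal paired with
  -- `ρ` gives `Tr P = ‖Y‖₁ / 2 ≤ D`.
  have h2 := hsep _ (hP.mul_mul_conjTranspose_same (C ⊗ₖ (1 : Matrix B B ℂ))) h1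
  have hone : (M ⊗ₖ (1 : Matrix B B ℂ)) * (C ⊗ₖ (1 : Matrix B B ℂ)) = 1 := by
    rw [← Matrix.mul_kronecker_mul, hMC, Matrix.one_mul, Matrix.one_kronecker_one]
  have hfac : ρ ⊗ₖ (1 : Matrix B B ℂ) = (M ⊗ₖ (1 : Matrix B B ℂ))ᴴ * (M ⊗ₖ (1 : Matrix B B ℂ)) := by
    rw [Matrix.conjTranspose_kronecker, ← Matrix.mul_kronecker_mul, hMM]
    simp
  have h3 : (ρ * marginal ((C ⊗ₖ (1 : Matrix B B ℂ)) * P * (C ⊗ₖ (1 : Matrix B B ℂ))ᴴ)).trace =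
      P.trace := by
    rw [trace_mul_marginal, hfac, Matrix.mul_assoc, Matrix.trace_mul_comm]
    calc _ = (((M ⊗ₖ (1 : Matrix B B ℂ)) * (C ⊗ₖ (1 : Matrix B B ℂ))) * P *
          ((M ⊗ₖ (1 : Matrix B B ℂ)) * (C ⊗ₖ (1 : Matrix B B ℂ)))ᴴ).trace := by
          rw [Matrix.conjTranspose_mul]; simp only [Matrix.mul_assoc]
      _ = P.trace := by rw [hone]; simp
  rw [h3, hPt, hYt, Complex.zero_re] at h2
  linarith

end StrongDuality

/-! ### The diamond norm as a finite supremum. -/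

section DiamondNorm

variable {A B : Type*} [Fintype A] [DecidableEq A] [Fintype B] [DecidableEq B]

theorem diamondNorm_nonneg (Φ : LMap A B) : 0 ≤ diamondNorm Φ := by
  refine Real.sSup_nonneg ?_
  rintro r ⟨k, X, -, rfl⟩
  exact (Complex.le_def.1 (CFC.abs_nonneg (ampliate (Fin k) Φ X)).posSemidef.trace_nonneg).1

theorem mem_upperBounds_of_dominating {Φ : LMap A B} (hm : marginal (choi Φ) = 0)
    {ω : Matrix (A × B) (A × B) ℂ} (hω : ω.PosSemidef) (hωΦ : (ω - choi Φ).PosSemidef) :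
    2 * opNorm (marginal ω) ∈ upperBounds {r : ℝ | ∃ (k : ℕ) (X : Matrix (Fin k × A) (Fin k × A) ℂ),
      traceNorm X ≤ 1 ∧ r = traceNorm (ampliate (Fin k) Φ X)} := by
  rintro r ⟨k, X, hX, rfl⟩
  have hc := (opNorm_le_iff (marginal_posSemidef hω) (opNorm_nonneg _)).1 le_rfl
  refine (traceNorm_ampliate_le hm hω hωΦ hc X).trans ?_
  exact mul_le_of_le_one_right (mul_nonneg zero_le_two (opNorm_nonneg _)) hX

theorem diamondNorm_div_two_le {Φ : LMap A B} (hm : marginal (choi Φ) = 0)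
    {ω : Matrix (A × B) (A × B) ℂ} (hω : ω.PosSemidef) (hωΦ : (ω - choi Φ).PosSemidef) :
    diamondNorm Φ / 2 ≤ opNorm (marginal ω) := by
  have h : diamondNorm Φ ≤ 2 * opNorm (marginal ω) :=
    Real.sSup_le (fun r hr => mem_upperBounds_of_dominating hm hω hωΦ hr)
      (mul_nonneg zero_le_two (opNorm_nonneg _))
  linarith

theorem exists_dominating_marginal_le_diamondNorm [Nonempty A] {Φ : LMap A B}
    (hJ : (choi Φ).IsHermitian) (hm : marginal (choi Φ) = 0) :
    ∃ ω : Matrix (A × B) (A × B) ℂ, ω.PosSemidef ∧ (ω - choi Φ).PosSemidef ∧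
      ((diamondNorm Φ / 2) • (1 : Matrix A A ℂ) - marginal ω).PosSemidef := by
  -- Any feasible matrix shows that the set is bounded above, without which the real `sSup` would be
  -- the default value `0`.
  obtain ⟨P, h1, h2, -⟩ := exists_posSemidef_ge hJ
  refine exists_dominating hJ hm fun k X hX => ?_
  rw [mul_div_cancel₀ _ two_ne_zero]
  exact le_csSup ⟨_, mem_upperBounds_of_dominating hm h1 h2⟩ ⟨k, X, hX, rfl⟩

end DiamondNorm

/-! ### Completing a dominating matrix to a multiple of a channel. -/

section Channels

variable {A B : Type*} [Fintype B]

theorem nonempty_of_isCPTP [Fintype A] [DecidableEq A] [Nonempty A] {N : LMap A B}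
    (hN : IsCPTP N) : Nonempty B := by
  by_contra h
  rw [not_nonempty_iff] at h
  have h1 := hN.trace_map 1
  simp [Matrix.trace_one, eq_comm] at h1

variable [DecidableEq B]

theorem marginal_kronecker_smul_one [Nonempty B] (G : Matrix A A ℂ) :
    marginal (G ⊗ₖ ((Fintype.card B : ℝ)⁻¹ • (1 : Matrix B B ℂ))) = G := by
  ext x y
  simp [marginal, mul_left_comm]

variable [Fintype A] [DecidableEq A]

/-- A dominating matrix with marginal at most `D` can be completed to `D` times a channel. -/
theorem exists_isCPTP_of_dominating [Nonempty A] {N : LMap A B} (hN : IsCPTP N)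
    {J ω : Matrix (A × B) (A × B) ℂ} {D : ℝ} (hD : 0 ≤ D) (hω : ω.PosSemidef)
    (hωJ : (ω - J).PosSemidef) (hm : (D • (1 : Matrix A A ℂ) - marginal ω).PosSemidef) :
    ∃ E : LMap A B, IsCPTP E ∧ (D • choi E - J).PosSemidef := by
  have := nonempty_of_isCPTP hN
  -- For `D = 0` one cannot rescale by `D⁻¹`, but then `ω = 0` and `-J ≥ 0`, so any channel serves.
  rcases hD.eq_or_lt with rfl | hD
  · refine ⟨N, hN, ?_⟩
    have h0 : ω = 0 := by
      rw [← hω.trace_eq_zero_iff, ← trace_marginal]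
      refine le_antisymm ?_ (marginal_posSemidef hω).trace_nonneg
      have h := hm.trace_nonneg
      simpa using h
    simpa [h0] using hωJ
  -- The missing marginal is tensored with the maximally mixed state of `B`, so `τ ≥ ω` has marginal
  -- exactly `D`.
  · set τ := ω + (D • (1 : Matrix A A ℂ) - marginal ω) ⊗ₖ
      ((Fintype.card B : ℝ)⁻¹ • (1 : Matrix B B ℂ)) with hτ
    have hk : ((D • (1 : Matrix A A ℂ) - marginal ω) ⊗ₖ
        ((Fintype.card B : ℝ)⁻¹ • (1 : Matrix B B ℂ))).PosSemidef :=
      hm.kronecker (PosSemidef.one.smul (inv_nonneg.2 (Nat.cast_nonneg _)))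
    have hDτ : D • D⁻¹ • τ = τ := smul_inv_smul₀ hD.ne' τ
    refine ⟨ofChoi (D⁻¹ • τ), (isCPTP_iff_choi _).2 ⟨?_, ?_⟩, ?_⟩
    · rw [choi_ofChoi]
      exact (hω.add hk).smul (inv_nonneg.2 hD.le)
    · rw [choi_ofChoi, marginal_smul, hτ, marginal_add, marginal_kronecker_smul_one,
        add_sub_cancel, inv_smul_smul₀ hD.ne']
    · rw [choi_ofChoi, hDτ, hτ, add_sub_right_comm]
      exact hωJ.add hk

theorem cpLe_smul_iff (Φ E : LMap A B) (r : ℝ) :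
    CPLe Φ (r • E) ↔ (r • choi E - choi Φ).PosSemidef := by
  rw [CPLe, isCP_iff_choi_posSemidef, choi_sub, choi_smul]

end Channels

/-! ### Exponentiating the max relative entropy. -/

section MaxRelativeEntropy

theorem twoPow_log_div (x : ℝ≥0∞) :
    twoPow (ENNReal.log x / ((Real.log 2 : ℝ) : EReal)) = x := by
  have h2 : 0 < Real.log 2 := Real.log_pos one_lt_two
  rw [twoPow, mul_comm, EReal.div_mul_cancel (EReal.coe_ne_bot _) (EReal.coe_ne_top _)
    (by exact_mod_cast h2.ne'), ENNReal.exp_log]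

theorem twoPow_le_twoPow_iff {x y : EReal} : twoPow x ≤ twoPow y ↔ x ≤ y := by
  have h2 : (0 : EReal) < (Real.log 2 : ℝ) := by exact_mod_cast Real.log_pos one_lt_two
  have hy : y * (Real.log 2 : ℝ) / (Real.log 2 : ℝ) = y := by
    rw [← EReal.mul_div_right, EReal.div_mul_cancel (EReal.coe_ne_bot _) (EReal.coe_ne_top _) h2.ne']
  rw [twoPow, twoPow, EReal.exp_le_exp_iff, mul_comm, mul_comm _ y,
    ← EReal.le_div_iff_mul_le h2 (EReal.coe_ne_top _), hy]

theorem twoPow_dMax {A B : Type*} (Φ Ψ : LMap A B) : twoPow (dMax Φ Ψ) =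
    sInf {s : ℝ≥0∞ | ∃ t : ℝ≥0, s = (t : ℝ≥0∞) ∧ CPLe Φ ((t : ℝ) • Ψ)} :=
  twoPow_log_div _

end MaxRelativeEntropy

end QChannel

end

theorem mainTheorem4 {A B : Type*} [Fintype A] [DecidableEq A] [Nonempty A]
    [Fintype B] [DecidableEq B] (N M : QChannel.LMap A B)
    (hN : QChannel.IsCPTP N) (hM : QChannel.IsCPTP M) :
    IsLeast {r : ℝ | ∃ ω : Matrix (A × B) (A × B) ℂ,
        ω.PosSemidef ∧ (ω - QChannel.choi (N - M)).PosSemidef ∧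
          r = QChannel.opNorm (QChannel.marginal ω)}
      (QChannel.diamondNorm (N - M) / 2) ∧
    IsLeast {r : ℝ | ∃ E : QChannel.LMap A B, QChannel.IsCPTP E ∧
        (r • QChannel.choi E - QChannel.choi (N - M)).PosSemidef}
      (QChannel.diamondNorm (N - M) / 2) ∧
    IsLeast {r : ℝ | ∃ E : QChannel.LMap A B, QChannel.IsCPTP E ∧
        QChannel.CPLe (N - M) (r • E)}
      (QChannel.diamondNorm (N - M) / 2) ∧
    IsLeast {s : ENNReal | ∃ E : QChannel.LMap A B, QChannel.IsCPTP E ∧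
        s = QChannel.twoPow (QChannel.dMax (N - M) E)}
      (ENNReal.ofReal (QChannel.diamondNorm (N - M) / 2)) ∧
    QChannel.twoPow (QChannel.logRobustnessCPTP (N - M)) =
      ENNReal.ofReal (QChannel.diamondNorm (N - M) / 2) := by
  open QChannel in
  obtain ⟨hN1, hN2⟩ := (isCPTP_iff_choi N).1 hN
  obtain ⟨hM1, hM2⟩ := (isCPTP_iff_choi M).1 hM
  have hJ : (choi (N - M)).IsHermitian := by
    rw [choi_sub]
    exact hN1.isHermitian.sub hM1.isHermitian
  have hm : marginal (choi (N - M)) = 0 := by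
    rw [choi_sub, marginal_sub, hN2, hM2, sub_self]
  have hD : 0 ≤ diamondNorm (N - M) / 2 := div_nonneg (diamondNorm_nonneg _) zero_le_two
  obtain ⟨ω, hω, hωJ, hωD⟩ := exists_dominating_marginal_le_diamondNorm hJ hm
  obtain ⟨E, hE, hEJ⟩ := exists_isCPTP_of_dominating hN hD hω hωJ hωD
  have hlow {r : ℝ} {F : LMap A B} (hF : IsCPTP F)
      (hr : (r • choi F - choi (N - M)).PosSemidef) : diamondNorm (N - M) / 2 ≤ r := by
    obtain ⟨hF1, hF2⟩ := (isCPTP_iff_choi F).1 hF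
    -- The marginal of `r • choi F - choi (N - M)` is `r • 1`, so positivity forces `r ≥ 0`.
    have hr0 : 0 ≤ r := by
      have h := (Complex.le_def.1 (marginal_posSemidef hr).trace_nonneg).1
      rw [marginal_sub, marginal_smul, hm, hF2, sub_zero, Matrix.trace_smul,
        Matrix.trace_one] at h
      have hA : (0 : ℝ) < Fintype.card A := by exact_mod_cast Fintype.card_pos
      exact nonneg_of_mul_nonneg_left (by simpa using h) hA
    have h := diamondNorm_div_two_le hm (hF1.smul hr0) hr
    rwa [marginal_smul, hF2, opNorm_smul_one hr0] at h
  have hlow' (F : LMap A B) (hF : IsCPTP F) :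
      ENNReal.ofReal (diamondNorm (N - M) / 2) ≤ twoPow (dMax (N - M) F) := by
    rw [twoPow_dMax]
    refine le_sInf ?_
    rintro s ⟨t, rfl, ht⟩
    rw [← ENNReal.ofReal_coe_nnreal]
    exact ENNReal.ofReal_le_ofReal (hlow hF ((cpLe_smul_iff _ _ _).1 ht))
  have hEmax : twoPow (dMax (N - M) E) = ENNReal.ofReal (diamondNorm (N - M) / 2) := by
    refine le_antisymm ?_ (hlow' E hE)
    rw [twoPow_dMax]
    refine sInf_le ⟨Real.toNNReal (diamondNorm (N - M) / 2), rfl, ?_⟩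
    rw [Real.coe_toNNReal _ hD]
    exact (cpLe_smul_iff _ _ _).2 hEJ
  refine ⟨⟨⟨ω, hω, hωJ, ?_⟩, ?_⟩, ⟨⟨E, hE, hEJ⟩, ?_⟩, ⟨⟨E, hE, (cpLe_smul_iff _ _ _).2 hEJ⟩, ?_⟩,
    ⟨⟨E, hE, hEmax.symm⟩, ?_⟩, ?_⟩
  · exact le_antisymm (diamondNorm_div_two_le hm hω hωJ)
      ((opNorm_le_iff (marginal_posSemidef hω) hD).2 hωD)
  · rintro r ⟨τ, hτ, hτJ, rfl⟩
    exact diamondNorm_div_two_le hm hτ hτJ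
  · rintro r ⟨F, hF, hr⟩
    exact hlow hF hr
  · rintro r ⟨F, hF, hr⟩
    exact hlow hF ((cpLe_smul_iff _ _ _).1 hr)
  · rintro s ⟨F, hF, rfl⟩
    exact hlow' F hF
  -- `E` minimises `2 ^ D_max`, and `twoPow` reflects the order, so `E` attains the infimum of
  -- `D_max` as well.
  · have h : logRobustnessCPTP (N - M) = dMax (N - M) E := by
      refine le_antisymm (sInf_le ⟨E, hE, rfl⟩) (le_sInf ?_)
      rintro d ⟨F, hF, rfl⟩
      exact twoPow_le_twoPow_iff.1 (hEmax.trans_le (hlow' F hF))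
    rw [h, hEmax]
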